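/- Let $(W,S)$ be a right-angled Coxeter system, i.e. all entries of its Coxeter matrix lie in $\{1,2,\infty\}$. Let $\ell$ be the length function with respect to $S$, and let $\le_R$ be the right weak order on $W$, the partial order generated by the relations $w <_R ws$ for $w\in W$, $s\in S$ with $\ell(ws)=\ell(w)+1$. Write $[u,v]_R$ for its intervals. For $w\in W$ let $T_L(w)$ be the set of left inversions of $w$, i.e. the $W$-conjugates $t$ of elements of $S$ with $\ell(tw)<\ell(w)$. Let $\mathrm{Cay}(W)$ be the undirected right Cayley graph of $W$ with respect to $S$ (edges $\{w,ws\}$ for $w\in W$, $s\in S$), with shortest-path distance $d$. A set $C\subseteq W$ is convex if $w\in C$ whenever $u,v\in C$ and $d(u,w)+d(w,v)=d(u,v)$; $\mathrm{conv}(X)$ denotes the intersection of all convex sets containing $X$. Then: 1. Any two elements $u,v\in W$ have a meet (greatest lower bound) $u\wedge_R v$ in $(W,\le_R)$, and $T_L(u\wedge_R v)=T_L(u)\cap T_L(v)$. 2. For all $u,v\in W$, the map $x\mapsto (x\wedge_R u,\;x\wedge_R v)$ is an injection from $\mathrm{conv}(\mathrm{id},u,v)$ into $[\mathrm{id},u]_R\times[\mathrm{id},v]_R$.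 3. $\mathrm{Cay}(W)$ has the strong hull property: it is connected, and for all $u,v,w\in W$, $$|\mathrm{conv}(u,v)|\cdot|\mathrm{conv}(v,w)|\ \ge\ |\mathrm{conv}(u,v,w)|.$$ -/

import Mathlib

/-- A set of vertices is (geodesically) convex if it contains every vertex lying on a shortest path
between two of its members. Meant for connected graphs, where `G.dist` is the graph metric. -/
def SimpleGraph.IsGeodConvex {V : Type*} (G : SimpleGraph V) (C : Set V) : Prop :=
  ∀ u ∈ C, ∀ v ∈ C, ∀ w : V, G.dist u w + G.dist w v = G.dist u v → w ∈ C

/-- The convex hull: the intersection of all convex sets containing `X`. -/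
def SimpleGraph.geodHull {V : Type*} (G : SimpleGraph V) (X : Set V) : Set V :=
  ⋂₀ {C : Set V | G.IsGeodConvex C ∧ X ⊆ C}

/-- The strong hull property of a connected graph:
`|conv(u,v)| * |conv(v,w)| ≥ |conv(u,v,w)|` for all vertices `u, v, w`. -/
def SimpleGraph.StrongHullProperty {V : Type*} (G : SimpleGraph V) : Prop :=
  G.Connected ∧ ∀ u v w : V,
    Cardinal.mk (G.geodHull {u, v, w}) ≤
      Cardinal.mk (G.geodHull {u, v}) * Cardinal.mk (G.geodHull {v, w})

/-- All entries lie in `{1, 2, ∞}`; a Coxeter matrix in Mathlib encodes `∞` as `0`. -/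
def CoxeterMatrix.IsRightAngled {B : Type*} (M : CoxeterMatrix B) : Prop :=
  ∀ i j : B, M i j = 1 ∨ M i j = 2 ∨ M i j = 0

namespace CoxeterSystem

/-- The undirected right Cayley graph with respect to the simple reflections. -/
def cayleyGraph {B W : Type*} [Group W] {M : CoxeterMatrix B} (cs : CoxeterSystem M W) :
    SimpleGraph W :=
  SimpleGraph.mulCayley (Set.range cs.simple)

/-- The cover relation of the right weak order: `w ⋖ w s` with `s` simple and
`ℓ (w s) = ℓ w + 1`. -/
def WeakCovers {B W : Type*} [Group W] {M : CoxeterMatrix B} (cs : CoxeterSystem M W)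
    (w w' : W) : Prop :=
  ∃ i : B, w' = w * cs.simple i ∧ cs.length (w * cs.simple i) = cs.length w + 1

/-- The right weak order, generated by its cover relations. -/
def WeakLE {B W : Type*} [Group W] {M : CoxeterMatrix B} (cs : CoxeterSystem M W) :
    W → W → Prop :=
  Relation.ReflTransGen cs.WeakCovers

/-- The interval `[u, v]` in the right weak order. -/
def weakInterval {B W : Type*} [Group W] {M : CoxeterMatrix B} (cs : CoxeterSystem M W)
    (u v : W) : Set W :=
  {x : W | cs.WeakLE u x ∧ cs.WeakLE x v}

/-- `m` is the greatest lower bound of `u` and `v` in the right weak order. -/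
def IsWeakMeet {B W : Type*} [Group W] {M : CoxeterMatrix B} (cs : CoxeterSystem M W)
    (u v m : W) : Prop :=
  cs.WeakLE m u ∧ cs.WeakLE m v ∧ ∀ z : W, cs.WeakLE z u → cs.WeakLE z v → cs.WeakLE z m

theorem WeakLE.eq_or_length_lt {B W : Type*} [Group W] {M : CoxeterMatrix B}
    {cs : CoxeterSystem M W} {u v : W} (h : cs.WeakLE u v) :
    u = v ∨ cs.length u < cs.length v := by
  induction h with
  | refl => exact Or.inl rfl
  | tail _ hc ih =>
    obtain ⟨i, rfl, hi⟩ := hc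
    right
    rcases ih with rfl | ih <;> omega

theorem WeakLE.antisymm {B W : Type*} [Group W] {M : CoxeterMatrix B}
    {cs : CoxeterSystem M W} {u v : W} (h : cs.WeakLE u v) (h' : cs.WeakLE v u) : u = v := by
  rcases h.eq_or_length_lt with e | e
  · exact e
  · rcases h'.eq_or_length_lt with e' | e'
    · exact e'.symm
    · omega

theorem IsWeakMeet.unique {B W : Type*} [Group W] {M : CoxeterMatrix B}
    {cs : CoxeterSystem M W} {u v m m' : W} (h : cs.IsWeakMeet u v m)
    (h' : cs.IsWeakMeet u v m') : m = m' :=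
  (h'.2.2 m h.1 h.2.1).antisymm (h.2.2 m' h'.1 h'.2.1)

open Classical in
/-- The meet `u ∧ v` in the right weak order, that is, the unique greatest lower bound
(with the default value `1` if there were none). -/
noncomputable def weakMeet {B W : Type*} [Group W] {M : CoxeterMatrix B} (cs : CoxeterSystem M W)
    (u v : W) : W :=
  if h : ∃ m : W, cs.IsWeakMeet u v m then h.choose else 1

/-- The set of left inversions of `w`: reflections `t` with `ℓ (t w) < ℓ w`. -/
def leftInversions {B W : Type*} [Group W] {M : CoxeterMatrix B} (cs : CoxeterSystem M W)
    (w : W) : Set W :=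
  {t : W | cs.IsLeftInversion w t}

end CoxeterSystem

/-!
The map `w ↦ T_L(w)` embeds the Cayley graph isometrically into a hypercube and turns the weak
order into inclusion. This rests on the cocycle identity `T_L(w x) = T_L(w) ∆ w T_L(x) w⁻¹`
(`mem_leftInversions_mul`). The cocycle is first built from the presentation, as the orbit of `∅`
under an action of `W` on `Set W`; for a right-angled system the relations are just involutivity
and commutation. Comparison with the inversion sequence of a reduced word shows that its value
at `w` is `T_L(w)`, a set with `ℓ(w)` elements.

The point where right-angledness matters further is that two left descents of one element commute
(`commute_of_mem_leftInversions`): two non-commuting simple reflections generate an infinite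
dihedral group, which has no element with both as descents. An induction on length then shows that
elements without a common left descent have disjoint inversion sets (`disjoint_leftInversions`).
Let `m` be a longest common lower bound of `u` and `v`. The elements `m⁻¹ u` and `m⁻¹ v` have no
common left descent, so `T_L(m) = T_L(u) ∩ T_L(v)`, and `m` is the meet.

For any set `A`, the set of all `x` with `T_L(x) ⊆ A` is convex, so `x ∈ conv(1, u, v)` implies
`T_L(x) ⊆ T_L(u) ∪ T_L(v)`. Hence `T_L(x)` is the union of the inversion sets of `x ∧ u` and
`x ∧ v`, and `x` is determined by these two meets. They lie in `[1, u]` and `[1, v]`, which are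
contained in `conv(1, u)` and `conv(1, v)`. This gives the strong hull inequality for triples
containing `1`, and left translation gives the general case.
-/

namespace CoxeterSystem

section RightAngled

variable {B W : Type*} [Group W] {M : CoxeterMatrix B} (cs : CoxeterSystem M W)

/-! ### The reflection cocycle -/

/-- The transformation `A ↦ {s i} ∆ (s i) A (s i)` of sets of group elements by which the simple
reflection `s i` acts in the reflection cocycle. -/
def reflectionStep (i : B) : Function.End (Set W) :=
  fun A => {t | Xor (t = cs.simple i) (cs.simple i * t * cs.simple i ∈ A)}

theorem mem_reflectionStep {i : B} {A : Set W} {t : W} :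
    t ∈ cs.reflectionStep i A ↔ Xor (t = cs.simple i) (cs.simple i * t * cs.simple i ∈ A) :=
  Iff.rfl

theorem commute_simple_of_eq_two {i j : B} (h : M i j = 2) :
    Commute (cs.simple i) (cs.simple j) := by
  have h1 := cs.simple_mul_simple_pow i j
  rw [h, pow_two, mul_eq_one_iff_eq_inv] at h1
  simpa [Commute, SemiconjBy] using h1

theorem reflectionStep_mul_self (i : B) : cs.reflectionStep i * cs.reflectionStep i = 1 := by
  funext A
  change cs.reflectionStep i (cs.reflectionStep i A) = A
  ext t
  have h : cs.simple i * t * cs.simple i = cs.simple i ↔ t = cs.simple i := by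
    rw [mul_eq_right, mul_eq_one_iff_inv_eq, cs.inv_simple, eq_comm]
  have h' : cs.simple i * (cs.simple i * t * cs.simple i) * cs.simple i = t := by simp [mul_assoc]
  rw [mem_reflectionStep, mem_reflectionStep, h, h']
  unfold Xor
  tauto

theorem commute_reflectionStep_of_eq_two {i j : B} (h : M i j = 2) :
    Commute (cs.reflectionStep i) (cs.reflectionStep j) := by
  have hc := cs.commute_simple_of_eq_two h
  funext A
  change cs.reflectionStep i (cs.reflectionStep j A) = cs.reflectionStep j (cs.reflectionStep i A)
  ext t
  have key : ∀ {a b : B}, Commute (cs.simple a) (cs.simple b) →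
      (cs.simple a * t * cs.simple a = cs.simple b ↔ t = cs.simple b) := by
    intro a b hab
    rw [← eq_mul_inv_iff_mul_eq, cs.inv_simple, ← hab.eq, mul_right_inj]
  have hA : cs.simple j * (cs.simple i * t * cs.simple i) * cs.simple j =
      cs.simple i * (cs.simple j * t * cs.simple j) * cs.simple i := by
    calc _ = (cs.simple j * cs.simple i) * t * (cs.simple i * cs.simple j) := by group
      _ = (cs.simple i * cs.simple j) * t * (cs.simple j * cs.simple i) := by rw [hc.eq]
      _ = _ := by group
  simp only [mem_reflectionStep, key hc, key hc.symm, hA]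
  unfold Xor
  tauto

/-- In a right-angled system the transformations `reflectionStep` satisfy the Coxeter relations;
only involutivity and commutation have to be checked. -/
theorem isLiftable_reflectionStep (hM : M.IsRightAngled) : M.IsLiftable cs.reflectionStep := by
  intro i j
  rcases hM i j with h | h | h
  · have hij : i = j := by
      by_contra hne
      exact M.off_diagonal i j hne h
    rw [h, pow_one, hij, cs.reflectionStep_mul_self]
  · rw [h, (cs.commute_reflectionStep_of_eq_two h).mul_pow, pow_two, pow_two,
      cs.reflectionStep_mul_self, cs.reflectionStep_mul_self, one_mul]
  · rw [h, pow_zero]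

/-- The action of `W` on sets of group elements which encodes the reflection cocycle. -/
def reflectionAction (hM : M.IsRightAngled) : W →* Function.End (Set W) :=
  cs.lift ⟨cs.reflectionStep, cs.isLiftable_reflectionStep hM⟩

theorem mem_reflectionAction_simple_mul (hM : M.IsRightAngled) {i : B} {w t : W} {A : Set W} :
    t ∈ cs.reflectionAction hM (cs.simple i * w) A ↔
      Xor (t = cs.simple i) (cs.simple i * t * cs.simple i ∈ cs.reflectionAction hM w A) := by
  rw [map_mul]
  change t ∈ cs.reflectionAction hM (cs.simple i) (cs.reflectionAction hM w A) ↔ _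
  rw [reflectionAction, cs.lift_apply_simple, mem_reflectionStep]

theorem mem_reflectionAction_one (hM : M.IsRightAngled) {t : W} {A : Set W} :
    t ∈ cs.reflectionAction hM 1 A ↔ t ∈ A := by
  rw [map_one]; rfl

/-- The action is affine over `ZMod 2`: `w` sends `A` to `N(w) ∆ w A w⁻¹`, where `N(w)` is the
image of the empty set. -/
theorem mem_reflectionAction (hM : M.IsRightAngled) {w t : W} {A : Set W} :
    t ∈ cs.reflectionAction hM w A ↔
      Xor (t ∈ cs.reflectionAction hM w ∅) (w⁻¹ * t * w ∈ A) := by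
  induction w using cs.simple_induction_left generalizing t with
  | one =>
    rw [mem_reflectionAction_one, mem_reflectionAction_one]
    simp [Xor]
  | mul_simple_left w i ih =>
    have h : (cs.simple i * w)⁻¹ * t * (cs.simple i * w) =
        w⁻¹ * (cs.simple i * t * cs.simple i) * w := by simp [mul_assoc]
    rw [mem_reflectionAction_simple_mul, ih, mem_reflectionAction_simple_mul, h]
    unfold Xor
    tauto

theorem mem_leftInvSeq_cons {i : B} {ω : List B} {t : W} :
    t ∈ cs.leftInvSeq (i :: ω) ↔
      t = cs.simple i ∨ cs.simple i * t * cs.simple i ∈ cs.leftInvSeq ω := by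
  rw [leftInvSeq, List.mem_cons, List.mem_map]
  refine or_congr_right ⟨?_, fun h => ⟨_, h, by simp [mul_assoc]⟩⟩
  rintro ⟨x, hx, rfl⟩
  simpa [mul_assoc] using hx

theorem mem_reflectionAction_wordProd (hM : M.IsRightAngled) {ω : List B}
    (hω : (cs.leftInvSeq ω).Nodup) {t : W} :
    t ∈ cs.reflectionAction hM (cs.wordProd ω) ∅ ↔ t ∈ cs.leftInvSeq ω := by
  induction ω generalizing t with
  | nil =>
    rw [cs.wordProd_nil, mem_reflectionAction_one]
    simp
  | cons i ω ih =>
    have hω' := hω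
    rw [leftInvSeq, List.nodup_cons] at hω'
    rw [cs.wordProd_cons, mem_reflectionAction_simple_mul, ih (List.Nodup.of_map _ hω'.2),
      mem_leftInvSeq_cons]
    have h : ¬ (t = cs.simple i ∧ cs.simple i * t * cs.simple i ∈ cs.leftInvSeq ω) := by
      rintro ⟨rfl, h⟩
      exact hω'.1 (List.mem_map.2 ⟨_, h, by simp⟩)
    unfold Xor
    tauto

/-- A reflection lies in its own cocycle value. -/
theorem IsReflection.mem_reflectionAction_self (hM : M.IsRightAngled) {t : W}
    (ht : cs.IsReflection t) : t ∈ cs.reflectionAction hM t ∅ := by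
  obtain ⟨w, i, rfl⟩ := ht
  have happ : ∀ (x y : W) (A : Set W), cs.reflectionAction hM (x * y) A =
      cs.reflectionAction hM x (cs.reflectionAction hM y A) := by
    intro x y A; rw [map_mul]; rfl
  have h1 : w⁻¹ * (w * cs.simple i * w⁻¹) * w = cs.simple i := by group
  have h2 : cs.simple i ∈ cs.reflectionAction hM w⁻¹ ∅ ↔
      w * cs.simple i * w⁻¹ ∈ cs.reflectionAction hM w ∅ := by
    have h := cs.mem_reflectionAction hM (w := w) (t := w * cs.simple i * w⁻¹)
      (A := cs.reflectionAction hM w⁻¹ ∅)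
    rw [h1, ← happ, mul_inv_cancel, mem_reflectionAction_one] at h
    simp only [Set.mem_empty_iff_false, Xor] at h
    tauto
  have h3 : cs.simple i * cs.simple i * cs.simple i = cs.simple i := by simp
  rw [mul_assoc, happ, mem_reflectionAction, ← mul_assoc, h1, mem_reflectionAction_simple_mul, h3,
    h2]
  unfold Xor
  tauto

theorem mem_reflectionAction_empty_iff (hM : M.IsRightAngled) {w t : W} :
    t ∈ cs.reflectionAction hM w ∅ ↔ t ∈ cs.leftInversions w := by
  have hfwd : ∀ {w t : W}, t ∈ cs.reflectionAction hM w ∅ → cs.IsLeftInversion w t := by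
    intro w t h
    obtain ⟨ω, hω, rfl⟩ := cs.exists_isReduced w
    exact cs.isLeftInversion_of_mem_leftInvSeq hω
      ((cs.mem_reflectionAction_wordProd hM hω.nodup_leftInvSeq).1 h)
  refine ⟨hfwd, fun ⟨ht, hlt⟩ => ?_⟩
  by_contra hn
  -- If `t ∉ N(w)`, then `t ∈ N(t w)`, so `w = t (t w)` would be shorter than `t w`.
  have h : t ∈ cs.reflectionAction hM (t * w) ∅ := by
    rw [map_mul]
    change t ∈ cs.reflectionAction hM t (cs.reflectionAction hM w ∅)
    rw [mem_reflectionAction, inv_mul_cancel, one_mul]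
    exact Or.inl ⟨ht.mem_reflectionAction_self cs hM, hn⟩
  have h' := (hfwd h).2
  rw [← mul_assoc, ht.mul_self, one_mul] at h'
  omega

/-- The cocycle identity `T_L(w x) = T_L(w) ∆ w T_L(x) w⁻¹`. -/
theorem mem_leftInversions_mul (hM : M.IsRightAngled) {w x t : W} :
    t ∈ cs.leftInversions (w * x) ↔
      Xor (t ∈ cs.leftInversions w) (w⁻¹ * t * w ∈ cs.leftInversions x) := by
  simp only [← cs.mem_reflectionAction_empty_iff hM]
  rw [map_mul]
  exact cs.mem_reflectionAction hM

theorem mem_leftInversions_wordProd (hM : M.IsRightAngled) {ω : List B} (hω : cs.IsReduced ω)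
    {t : W} : t ∈ cs.leftInversions (cs.wordProd ω) ↔ t ∈ cs.leftInvSeq ω := by
  rw [← cs.mem_reflectionAction_empty_iff hM,
    cs.mem_reflectionAction_wordProd hM hω.nodup_leftInvSeq]

theorem finite_leftInversions (hM : M.IsRightAngled) (w : W) : (cs.leftInversions w).Finite := by
  obtain ⟨ω, hω, rfl⟩ := cs.exists_isReduced w
  exact (List.finite_toSet (cs.leftInvSeq ω)).subset
    fun t ht => (cs.mem_leftInversions_wordProd hM hω).1 ht

theorem ncard_leftInversions (hM : M.IsRightAngled) (w : W) :
    (cs.leftInversions w).ncard = cs.length w := by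
  classical
  obtain ⟨ω, hω, rfl⟩ := cs.exists_isReduced w
  have h : cs.leftInversions (cs.wordProd ω) = ((cs.leftInvSeq ω).toFinset : Set W) := by
    ext t
    rw [cs.mem_leftInversions_wordProd hM hω, Finset.mem_coe, List.mem_toFinset]
  rw [h, Set.ncard_coe_finset, List.toFinset_card_of_nodup hω.nodup_leftInvSeq,
    cs.length_leftInvSeq, hω.eq]

theorem leftInversions_one : cs.leftInversions 1 = ∅ := by
  ext t
  simp [leftInversions, IsLeftInversion]

theorem simple_mem_leftInversions {w : W} {i : B} :
    cs.simple i ∈ cs.leftInversions w ↔ cs.IsLeftDescent w i :=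
  cs.isLeftInversion_simple_iff_isLeftDescent w i

theorem mem_leftInversions_simple (hM : M.IsRightAngled) {i : B} {t : W} :
    t ∈ cs.leftInversions (cs.simple i) ↔ t = cs.simple i := by
  rw [← cs.wordProd_singleton, cs.mem_leftInversions_wordProd hM (by simp [IsReduced])]
  simp

theorem mem_leftInversions_simple_mul (hM : M.IsRightAngled) {w t : W} {i : B} :
    t ∈ cs.leftInversions (cs.simple i * w) ↔
      Xor (t = cs.simple i) (cs.simple i * t * cs.simple i ∈ cs.leftInversions w) := by
  rw [cs.mem_leftInversions_mul hM, cs.mem_leftInversions_simple hM, cs.inv_simple]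

theorem mem_leftInversions_mul_simple (hM : M.IsRightAngled) {w t : W} {i : B} :
    t ∈ cs.leftInversions (w * cs.simple i) ↔
      Xor (t ∈ cs.leftInversions w) (t = w * cs.simple i * w⁻¹) := by
  rw [cs.mem_leftInversions_mul hM, cs.mem_leftInversions_simple hM]
  have : w⁻¹ * t * w = cs.simple i ↔ t = w * cs.simple i * w⁻¹ := by
    constructor
    · rintro h; rw [← h]; group
    · rintro rfl; group
  rw [this]

theorem mem_leftInversions_inv_mul (hM : M.IsRightAngled) {u v t : W} :
    t ∈ cs.leftInversions (u⁻¹ * v) ↔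
      Xor (u * t * u⁻¹ ∈ cs.leftInversions u) (u * t * u⁻¹ ∈ cs.leftInversions v) := by
  have h := cs.mem_leftInversions_mul hM (w := u) (x := u⁻¹ * v) (t := u * t * u⁻¹)
  have e : u⁻¹ * (u * t * u⁻¹) * u = t := by group
  rw [mul_inv_cancel_left, e] at h
  unfold Xor at *
  tauto

theorem mem_leftInversions_inv (hM : M.IsRightAngled) {u t : W} :
    t ∈ cs.leftInversions u⁻¹ ↔ u * t * u⁻¹ ∈ cs.leftInversions u := by
  have h := cs.mem_leftInversions_inv_mul hM (u := u) (v := 1) (t := t)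
  rw [mul_one, cs.leftInversions_one] at h
  simpa [Xor] using h

theorem leftInversions_injective (hM : M.IsRightAngled) :
    Function.Injective cs.leftInversions := by
  intro u v h
  rw [← inv_mul_eq_one, ← cs.length_eq_zero_iff, ← cs.ncard_leftInversions hM]
  have : cs.leftInversions (u⁻¹ * v) = ∅ := by
    ext t
    rw [cs.mem_leftInversions_inv_mul hM, h]
    simp [Xor]
  rw [this, Set.ncard_empty]

/-- The map `w ↦ T_L(w)` carries the word metric to the Hamming metric. -/
theorem length_inv_mul (hM : M.IsRightAngled) (u v : W) :
    cs.length (u⁻¹ * v) = (symmDiff (cs.leftInversions u) (cs.leftInversions v)).ncard := by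
  have h : MulAut.conj u '' cs.leftInversions (u⁻¹ * v) =
      symmDiff (cs.leftInversions u) (cs.leftInversions v) := by
    ext t
    constructor
    · rintro ⟨x, hx, rfl⟩
      exact (cs.mem_leftInversions_inv_mul hM).1 hx
    · intro ht
      refine ⟨u⁻¹ * t * u, (cs.mem_leftInversions_inv_mul hM).2 ?_, by simp [mul_assoc]⟩
      have e : u * (u⁻¹ * t * u) * u⁻¹ = t := by group
      rw [e]
      exact ht
  rw [← h, Set.ncard_image_of_injective _ (MulAut.conj u).injective, cs.ncard_leftInversions hM]

/-! ### The weak order as inclusion of inversion sets -/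

theorem weakLE_iff_leftInversions_subset (hM : M.IsRightAngled) {u v : W} :
    cs.WeakLE u v ↔ cs.leftInversions u ⊆ cs.leftInversions v := by
  constructor
  · intro h
    induction h with
    | refl => exact subset_rfl
    | tail _ hc ih =>
      rename_i b c _
      obtain ⟨i, rfl, hi⟩ := hc
      intro t ht
      rw [cs.mem_leftInversions_mul_simple hM]
      refine Or.inl ⟨ih ht, ?_⟩
      rintro rfl
      have := (ih ht).2
      simp only [inv_mul_cancel_right] at this
      omega
  · intro h
    obtain ⟨n, hn⟩ : ∃ n, cs.length (u⁻¹ * v) = n := ⟨_, rfl⟩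
    induction n using Nat.strong_induction_on generalizing u with
    | _ n ih =>
      by_cases huv : u⁻¹ * v = 1
      · rw [inv_mul_eq_one.1 huv]
        exact Relation.ReflTransGen.refl
      · obtain ⟨i, hi⟩ := cs.exists_leftDescent_of_ne_one huv
        have h1 := (cs.mem_leftInversions_inv_mul hM).1 (cs.simple_mem_leftInversions.2 hi)
        -- The wall between `u` and `u s` is crossed on the way to `v`, so `u s` lies above `u`.
        have h2 : u * cs.simple i * u⁻¹ ∈ cs.leftInversions v ∧
            u * cs.simple i * u⁻¹ ∉ cs.leftInversions u := by
          rcases h1 with ⟨h1, h1'⟩ | h1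
          · exact absurd (h h1) h1'
          · exact h1
        have hsub : cs.leftInversions (u * cs.simple i) ⊆ cs.leftInversions v := by
          intro t ht
          rcases (cs.mem_leftInversions_mul_simple hM).1 ht with ⟨ht, -⟩ | ⟨rfl, -⟩
          · exact h ht
          · exact h2.1
        have hlen : cs.length (u * cs.simple i) = cs.length u + 1 := by
          refine (cs.length_mul_simple u i).resolve_right fun hd => h2.2 ⟨⟨u, i, rfl⟩, ?_⟩
          simp only [inv_mul_cancel_right]
          omega
        refine Relation.ReflTransGen.head ⟨i, rfl, hlen⟩ (ih _ ?_ hsub rfl)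
        have : (u * cs.simple i)⁻¹ * v = cs.simple i * (u⁻¹ * v) := by simp [mul_assoc]
        rw [this, ← hn]
        exact hi

/-! ### Descents of one element commute -/

/-- The alternating product `a * b * a * ⋯` with `n` factors, starting with `a`. -/
def altProd (a b : W) : ℕ → W
  | 0 => 1
  | n + 1 => a * altProd b a n

theorem exists_eq_altProd_of_mem_closure {i j : B} {w : W}
    (hw : w ∈ Subgroup.closure {cs.simple i, cs.simple j}) :
    ∃ n, w = altProd (cs.simple i) (cs.simple j) n ∨
      w = altProd (cs.simple j) (cs.simple i) n := by
  have key : ∀ (k l : B) (x : W), (∃ n, x = altProd (cs.simple k) (cs.simple l) n ∨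
      x = altProd (cs.simple l) (cs.simple k) n) →
      ∃ n, cs.simple k * x = altProd (cs.simple k) (cs.simple l) n ∨
        cs.simple k * x = altProd (cs.simple l) (cs.simple k) n := by
    rintro k l x ⟨n, rfl | rfl⟩
    · cases n with
      | zero => exact ⟨1, Or.inl rfl⟩
      | succ n => exact ⟨n, Or.inr (by rw [altProd, cs.simple_mul_simple_cancel_left])⟩
    · exact ⟨n + 1, Or.inl rfl⟩
  have key' : ∀ z ∈ ({cs.simple i, cs.simple j} : Set W), ∀ x : W,
      (∃ n, x = altProd (cs.simple i) (cs.simple j) n ∨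
        x = altProd (cs.simple j) (cs.simple i) n) →
      ∃ n, z * x = altProd (cs.simple i) (cs.simple j) n ∨
        z * x = altProd (cs.simple j) (cs.simple i) n := by
    rintro z (rfl | rfl) x hx
    · exact key i j x hx
    · obtain ⟨n, hn⟩ := key j i x (hx.imp fun _ => Or.symm)
      exact ⟨n, hn.symm⟩
  induction hw using Subgroup.closure_induction_left with
  | one => exact ⟨0, Or.inl rfl⟩
  | mul_left x hx y _ ih => exact key' x hx y ih
  | inv_mul_cancel x hx y _ ih =>
    have : x⁻¹ = x := by rcases hx with rfl | rfl <;> exact cs.inv_simple _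
    rw [this]
    exact key' x hx y ih

theorem exists_of_mem_leftInversions_altProd (hM : M.IsRightAngled) {i j : B} {n : ℕ} {t : W}
    (ht : t ∈ cs.leftInversions (altProd (cs.simple i) (cs.simple j) n)) :
    ∃ k : ℕ, t = (cs.simple i * cs.simple j) ^ k * cs.simple i := by
  induction n generalizing i j t with
  | zero => simp [altProd, leftInversions_one] at ht
  | succ n ih =>
    rw [altProd, cs.mem_leftInversions_simple_mul hM] at ht
    rcases ht with ⟨rfl, -⟩ | ⟨ht, -⟩
    · exact ⟨0, by simp⟩
    · obtain ⟨k, hk⟩ := ih ht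
      refine ⟨k + 1, ?_⟩
      have h1 : cs.simple i * (cs.simple i * t * cs.simple i) * cs.simple i = t := by
        simp [mul_assoc]
      have h2 : SemiconjBy (cs.simple i) ((cs.simple j * cs.simple i) ^ k)
          ((cs.simple i * cs.simple j) ^ k) :=
        SemiconjBy.pow_right (by simp [SemiconjBy, mul_assoc]) k
      rw [← h1, hk, ← mul_assoc, h2.eq, pow_succ]
      simp [mul_assoc]

/-- Two simple reflections with `M i j = 0` generate an infinite dihedral group: there is a
homomorphism to the infinite dihedral group that kills all other simple reflections. -/
theorem simple_mul_simple_pow_ne_one (hM : M.IsRightAngled) {i j : B} (h : M i j = 0) {n : ℕ}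
    (hn : n ≠ 0) : (cs.simple i * cs.simple j) ^ n ≠ 1 := by
  classical
  have hij : i ≠ j := by
    rintro rfl
    simp at h
  let f : B → DihedralGroup 0 := fun k =>
    if k = i then DihedralGroup.sr 0 else if k = j then DihedralGroup.sr 1 else 1
  have hsq : ∀ k, f k * f k = 1 := by
    intro k
    simp only [f]
    split_ifs <;> simp
  have hf : M.IsLiftable f := by
    intro k l
    rcases hM k l with e | e | e
    · have hkl : k = l := by
        by_contra hne
        exact M.off_diagonal k l hne e
      rw [e, pow_one, hkl, hsq]
    · have hc : Commute (f k) (f l) := by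
        by_cases hk : k = i
        · have hl : l ≠ j := by
            rintro rfl
            rw [hk, h] at e
            omega
          by_cases hl' : l = i
          · rw [hk, hl']
          · simp [f, hl, hl']
        · by_cases hk' : k = j
          · have hl : l ≠ i := by
              rintro rfl
              rw [hk', M.symmetric, h] at e
              omega
            by_cases hl' : l = j
            · rw [hk', hl']
            · simp [f, hl, hl']
          · simp [f, hk, hk']
      rw [e, hc.mul_pow, pow_two, pow_two, hsq, hsq, one_mul]
    · rw [e, pow_zero]
  intro h1
  have h2 := congrArg (cs.lift ⟨f, hf⟩) h1
  rw [map_pow, map_mul, cs.lift_apply_simple, cs.lift_apply_simple, map_one] at h2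
  have h3 : f i * f j = DihedralGroup.r 1 := by
    simp [f, hij.symm]
  rw [h3] at h2
  have h4 := orderOf_dvd_of_pow_eq_one h2
  rw [DihedralGroup.orderOf_r_one, zero_dvd_iff] at h4
  exact hn h4

/-- If `s i` and `s j` generate an infinite group, no element has both as left descents: write the
element as `w * q` with `w` in the dihedral group and `q` shortest in its coset, so that the
dihedral inversions of the element are those of `w`. -/
theorem not_simple_mem_leftInversions_of_eq_zero (hM : M.IsRightAngled) {i j : B}
    (h : M i j = 0) {z : W} (hi : cs.simple i ∈ cs.leftInversions z) :
    cs.simple j ∉ cs.leftInversions z := by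
  intro hj
  set D := Subgroup.closure {cs.simple i, cs.simple j} with hD
  have hiD : cs.simple i ∈ D := Subgroup.subset_closure (by simp)
  have hjD : cs.simple j ∈ D := Subgroup.subset_closure (by simp)
  obtain ⟨w, hw, hmin⟩ := WellFounded.has_min (measure fun w => cs.length (w⁻¹ * z)).wf
    (D : Set W) ⟨1, D.one_mem⟩
  have key : ∀ t ∈ D, t ∈ cs.leftInversions z → t ∈ cs.leftInversions w := by
    intro t htD ht
    rw [← mul_inv_cancel_left w z, cs.mem_leftInversions_mul hM] at ht
    rcases ht with ⟨ht, -⟩ | ⟨ht, -⟩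
    · exact ht
    · exfalso
      refine hmin (t⁻¹ * w) (D.mul_mem (D.inv_mem htD) hw) ?_
      have := ht.2
      simp only [InvImage, WellFoundedRelation.rel]
      convert this using 2
      simp [mul_assoc]
  have hiw := key _ hiD hi
  have hjw := key _ hjD hj
  have fin : ∀ {k l : B}, M k l = 0 → ∀ {n : ℕ},
      cs.simple l ∉ cs.leftInversions (altProd (cs.simple k) (cs.simple l) n) := by
    intro k l hkl n hmem
    obtain ⟨m, hm⟩ := cs.exists_of_mem_leftInversions_altProd hM hmem
    refine cs.simple_mul_simple_pow_ne_one hM hkl m.succ_ne_zero ?_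
    rw [pow_succ, ← mul_assoc, ← hm, cs.simple_mul_simple_self]
  obtain ⟨n, rfl | rfl⟩ := cs.exists_eq_altProd_of_mem_closure hw
  · exact fin h hjw
  · exact fin (by rw [M.symmetric, h]) hiw

theorem commute_of_mem_leftInversions (hM : M.IsRightAngled) {i j : B} {z : W}
    (hi : cs.simple i ∈ cs.leftInversions z) (hj : cs.simple j ∈ cs.leftInversions z) :
    Commute (cs.simple i) (cs.simple j) := by
  rcases hM i j with h | h | h
  · by_cases hne : i = j
    · rw [hne]
    · exact absurd h (M.off_diagonal i j hne)
  · exact cs.commute_simple_of_eq_two h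
  · exact absurd hj (cs.not_simple_mem_leftInversions_of_eq_zero hM h hi)

/-! ### Meets -/

/-- Elements without a common left descent have no common left inversion. A common inversion `t` of
`h` and `y` forces, by induction on the length of `h`, that `h` has exactly one right descent `a`,
with `t = h a h⁻¹`. If `r` is a right descent of `h a`, then `a` and `r` are both left descents of
`(h a)⁻¹ y`; so they commute, and `r` is a second right descent of `h`. -/
theorem disjoint_leftInversions (hM : M.IsRightAngled) {h y : W}
    (hd : ∀ i, cs.simple i ∈ cs.leftInversions h → cs.simple i ∉ cs.leftInversions y) :
    Disjoint (cs.leftInversions h) (cs.leftInversions y) := by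
  obtain ⟨n, hn⟩ : ∃ n, cs.length h = n := ⟨_, rfl⟩
  induction n using Nat.strong_induction_on generalizing h with
  | _ n ih =>
    rw [Set.disjoint_left]
    intro t hth hty
    have hdesc : ∀ i, cs.IsRightDescent h i ↔ h * cs.simple i * h⁻¹ ∈ cs.leftInversions h := by
      intro i
      rw [← cs.mem_leftInversions_inv hM, cs.simple_mem_leftInversions, isLeftDescent_inv_iff]
    have hsub : ∀ i, cs.IsRightDescent h i →
        cs.leftInversions (h * cs.simple i) ⊆ cs.leftInversions h := by
      intro i hi x hx
      rcases (cs.mem_leftInversions_mul_simple hM).1 hx with hx | ⟨rfl, -⟩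
      · exact hx.1
      · exact (hdesc i).1 hi
    have hdisj : ∀ i, cs.IsRightDescent h i →
        Disjoint (cs.leftInversions (h * cs.simple i)) (cs.leftInversions y) := by
      intro i hi
      exact ih _ (hn ▸ hi) (fun j hj => hd j (hsub i hi hj)) rfl
    have huniq : ∀ i, cs.IsRightDescent h i → t = h * cs.simple i * h⁻¹ := by
      intro i hi
      have h1 : t ∉ cs.leftInversions (h * cs.simple i) :=
        fun h2 => Set.disjoint_left.1 (hdisj i hi) h2 hty
      rw [cs.mem_leftInversions_mul_simple hM] at h1
      by_contra h2
      exact h1 (Or.inl ⟨hth, h2⟩)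
    have hne : h ≠ 1 := by
      rintro rfl
      simp [leftInversions_one] at hth
    obtain ⟨a, ha⟩ := cs.exists_rightDescent_of_ne_one hne
    have hta := huniq a ha
    by_cases h1 : h * cs.simple a = 1
    · have hha : h = cs.simple a := by rw [mul_eq_one_iff_eq_inv.1 h1, cs.inv_simple]
      have hta' : t = cs.simple a := by rw [hta, hha]; simp
      exact hd a (hta' ▸ hth) (hta' ▸ hty)
    · obtain ⟨r, hr⟩ := cs.exists_rightDescent_of_ne_one h1
      have hr' : h * cs.simple a * cs.simple r * (h * cs.simple a)⁻¹ ∈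
          cs.leftInversions (h * cs.simple a) := by
        rw [← cs.mem_leftInversions_inv hM, cs.simple_mem_leftInversions, isLeftDescent_inv_iff]
        exact hr
      have ha' : h * cs.simple a * cs.simple a * (h * cs.simple a)⁻¹ = t := by
        rw [hta]; simp [mul_assoc]
      have hta2 : t ∉ cs.leftInversions (h * cs.simple a) :=
        fun h2 => Set.disjoint_left.1 (hdisj a ha) h2 hty
      have hrz : cs.simple r ∈ cs.leftInversions ((h * cs.simple a)⁻¹ * y) := by
        rw [cs.mem_leftInversions_inv_mul hM]
        exact Or.inl ⟨hr', Set.disjoint_left.1 (hdisj a ha) hr'⟩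
      have haz : cs.simple a ∈ cs.leftInversions ((h * cs.simple a)⁻¹ * y) := by
        rw [cs.mem_leftInversions_inv_mul hM, ha']
        exact Or.inr ⟨hty, hta2⟩
      have hc := cs.commute_of_mem_leftInversions hM haz hrz
      have heq : h * cs.simple a * cs.simple r * (h * cs.simple a)⁻¹ =
          h * cs.simple r * h⁻¹ := by
        rw [mul_assoc h, hc.eq]; simp [mul_assoc]
      have hrh : cs.IsRightDescent h r := (hdesc r).2 (hsub a ha (heq ▸ hr'))
      have htr := huniq r hrh
      rw [← heq] at htr
      exact hta2 (htr ▸ hr')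

theorem exists_leftInversions_eq_inter (hM : M.IsRightAngled) (u v : W) :
    ∃ m, cs.leftInversions m = cs.leftInversions u ∩ cs.leftInversions v := by
  -- `m` is taken longest among the common lower bounds of `u` and `v`.
  obtain ⟨m, ⟨hmu, hmv⟩, hmax⟩ : ∃ m, (cs.leftInversions m ⊆ cs.leftInversions u ∧
      cs.leftInversions m ⊆ cs.leftInversions v) ∧ ∀ m', cs.leftInversions m' ⊆ cs.leftInversions u →
        cs.leftInversions m' ⊆ cs.leftInversions v → cs.length m' ≤ cs.length m := by
    obtain ⟨m, hm, hmin⟩ := WellFounded.has_min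
      (measure fun m => cs.length u - cs.length m).wf
      {m | cs.leftInversions m ⊆ cs.leftInversions u ∧ cs.leftInversions m ⊆ cs.leftInversions v}
      ⟨1, by simp [leftInversions_one]⟩
    refine ⟨m, hm, fun m' h1 h2 => ?_⟩
    have hlt : ¬ (cs.length u - cs.length m' < cs.length u - cs.length m) := hmin m' ⟨h1, h2⟩
    have hle : cs.length m' ≤ cs.length u := by
      rw [← cs.ncard_leftInversions hM, ← cs.ncard_leftInversions hM]
      exact Set.ncard_le_ncard h1 (cs.finite_leftInversions hM u)
    omega
  refine ⟨m, (Set.subset_inter hmu hmv).antisymm fun t ⟨htu, htv⟩ => ?_⟩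
  have hdisj : Disjoint (cs.leftInversions (m⁻¹ * u)) (cs.leftInversions (m⁻¹ * v)) := by
    refine cs.disjoint_leftInversions hM fun i hiu hiv => ?_
    rw [cs.mem_leftInversions_inv_mul hM] at hiu hiv
    have hsubs : ∀ {x : W}, cs.leftInversions m ⊆ cs.leftInversions x →
        Xor (m * cs.simple i * m⁻¹ ∈ cs.leftInversions m)
          (m * cs.simple i * m⁻¹ ∈ cs.leftInversions x) →
        m * cs.simple i * m⁻¹ ∉ cs.leftInversions m ∧
          cs.leftInversions (m * cs.simple i) ⊆ cs.leftInversions x := by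
      intro x hx h
      rcases h with ⟨h, h'⟩ | ⟨h, h'⟩
      · exact absurd (hx h) h'
      · refine ⟨h', fun y hy => ?_⟩
        rcases (cs.mem_leftInversions_mul_simple hM).1 hy with hy | ⟨rfl, -⟩
        · exact hx hy.1
        · exact h
    have h1 := hsubs hmu hiu
    have h2 := hmax _ h1.2 (hsubs hmv hiv).2
    rcases cs.length_mul_simple m i with h3 | h3
    · omega
    · refine h1.1 ⟨⟨m, i, rfl⟩, ?_⟩
      simp only [inv_mul_cancel_right]
      omega
  by_contra htm
  have e : m * (m⁻¹ * t * m) * m⁻¹ = t := by group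
  refine Set.disjoint_left.1 hdisj (show m⁻¹ * t * m ∈ _ from ?_) ?_ <;>
    rw [cs.mem_leftInversions_inv_mul hM, e]
  · exact Or.inr ⟨htu, htm⟩
  · exact Or.inr ⟨htv, htm⟩

theorem isWeakMeet_of_leftInversions_eq (hM : M.IsRightAngled) {u v m : W}
    (h : cs.leftInversions m = cs.leftInversions u ∩ cs.leftInversions v) :
    cs.IsWeakMeet u v m := by
  simp only [IsWeakMeet, cs.weakLE_iff_leftInversions_subset hM, h]
  exact ⟨Set.inter_subset_left, Set.inter_subset_right, fun z => Set.subset_inter⟩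

theorem isWeakMeet_weakMeet (hM : M.IsRightAngled) (u v : W) :
    cs.IsWeakMeet u v (cs.weakMeet u v) := by
  obtain ⟨m, hm⟩ := cs.exists_leftInversions_eq_inter hM u v
  have hex : ∃ m, cs.IsWeakMeet u v m := ⟨m, cs.isWeakMeet_of_leftInversions_eq hM hm⟩
  rw [weakMeet, dif_pos hex]
  exact hex.choose_spec

theorem leftInversions_weakMeet (hM : M.IsRightAngled) (u v : W) :
    cs.leftInversions (cs.weakMeet u v) = cs.leftInversions u ∩ cs.leftInversions v := by
  obtain ⟨m, hm⟩ := cs.exists_leftInversions_eq_inter hM u v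
  rw [(cs.isWeakMeet_weakMeet hM u v).unique (cs.isWeakMeet_of_leftInversions_eq hM hm), hm]

/-! ### Convex hulls in the Cayley graph -/

theorem cayleyGraph_adj {u v : W} : cs.cayleyGraph.Adj u v ↔ ∃ i, v = u * cs.simple i := by
  rw [cayleyGraph, SimpleGraph.mulCayley_adj']
  constructor
  · rintro ⟨-, g, ⟨i, rfl⟩, rfl | rfl⟩
    · exact ⟨i, rfl⟩
    · exact ⟨i, by simp⟩
  · rintro ⟨i, rfl⟩
    refine ⟨fun h => cs.length_mul_simple_ne u i (by rw [← h]), _, ⟨i, rfl⟩, Or.inl rfl⟩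

theorem exists_walk_length_eq (u v : W) :
    ∃ p : cs.cayleyGraph.Walk u v, p.length = cs.length (u⁻¹ * v) := by
  obtain ⟨ω, hω, h⟩ := cs.exists_isReduced (u⁻¹ * v)
  rw [h, hω.eq]
  have hv : v = u * cs.wordProd ω := by rw [← h, mul_inv_cancel_left]
  clear h hω
  subst hv
  induction ω generalizing u with
  | nil => exact ⟨SimpleGraph.Walk.nil.copy rfl (by simp), by simp⟩
  | cons i ω ih =>
    obtain ⟨p, hp⟩ := ih (u * cs.simple i)
    refine ⟨(SimpleGraph.Walk.cons (cs.cayleyGraph_adj.2 ⟨i, rfl⟩) p).copy rfl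
      (by rw [cs.wordProd_cons, mul_assoc]), by simp [hp]⟩

theorem length_inv_mul_le_walk_length {u v : W} (p : cs.cayleyGraph.Walk u v) :
    cs.length (u⁻¹ * v) ≤ p.length := by
  induction p with
  | nil => simp
  | cons hadj p ih =>
    rename_i a b c
    obtain ⟨i, rfl⟩ := cs.cayleyGraph_adj.1 hadj
    have h := cs.length_mul_le (cs.simple i) ((a * cs.simple i)⁻¹ * c)
    have e : cs.simple i * ((a * cs.simple i)⁻¹ * c) = a⁻¹ * c := by simp [mul_assoc]
    rw [e, cs.length_simple] at h
    rw [SimpleGraph.Walk.length_cons]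
    omega

theorem cayleyGraph_connected : cs.cayleyGraph.Connected :=
  { preconnected := fun u v => (cs.exists_walk_length_eq u v).choose.reachable
    nonempty := ⟨1⟩ }

theorem cayleyGraph_dist (u v : W) : cs.cayleyGraph.dist u v = cs.length (u⁻¹ * v) := by
  apply le_antisymm
  · obtain ⟨p, hp⟩ := cs.exists_walk_length_eq u v
    exact hp ▸ SimpleGraph.dist_le p
  · obtain ⟨p, hp⟩ := (cs.cayleyGraph_connected u v).exists_walk_length_eq_dist
    exact hp ▸ cs.length_inv_mul_le_walk_length p

theorem isGeodConvex_setOf_leftInversions_subset (hM : M.IsRightAngled) (A : Set W) :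
    cs.cayleyGraph.IsGeodConvex {x | cs.leftInversions x ⊆ A} := by
  intro u hu v hv w hw t ht
  by_contra htA
  have htu : t ∉ cs.leftInversions u := fun h => htA (hu h)
  have htv : t ∉ cs.leftInversions v := fun h => htA (hv h)
  simp only [cayleyGraph_dist, cs.length_inv_mul hM] at hw
  have hfin : ∀ x y : W, (symmDiff (cs.leftInversions x) (cs.leftInversions y)).Finite :=
    fun x y => ((cs.finite_leftInversions hM x).union (cs.finite_leftInversions hM y)).subset
      Set.symmDiff_subset_union
  -- The wall of `t` would be crossed twice on the way from `u` to `v` through `w`.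
  have hlt : (symmDiff (cs.leftInversions u) (cs.leftInversions v)).ncard <
      (symmDiff (cs.leftInversions u) (cs.leftInversions w) ∪
        symmDiff (cs.leftInversions w) (cs.leftInversions v)).ncard := by
    refine Set.ncard_lt_ncard ⟨symmDiff_triangle _ _ _, fun h => ?_⟩ ((hfin _ _).union (hfin _ _))
    rcases h (Or.inl (Or.inr ⟨ht, htu⟩)) with h | h
    · exact htu h.1
    · exact htv h.1
  have := Set.ncard_union_le (symmDiff (cs.leftInversions u) (cs.leftInversions w))
    (symmDiff (cs.leftInversions w) (cs.leftInversions v))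
  omega

theorem leftInversions_subset_of_mem_geodHull (hM : M.IsRightAngled) {u v x : W}
    (hx : x ∈ cs.cayleyGraph.geodHull {1, u, v}) :
    cs.leftInversions x ⊆ cs.leftInversions u ∪ cs.leftInversions v := by
  refine hx _ ⟨cs.isGeodConvex_setOf_leftInversions_subset hM _, ?_⟩
  rintro y (rfl | rfl | rfl)
  · simp [leftInversions_one]
  · exact Set.subset_union_left
  · exact Set.subset_union_right

theorem weakInterval_subset_geodHull (hM : M.IsRightAngled) (u : W) :
    cs.weakInterval 1 u ⊆ cs.cayleyGraph.geodHull {1, u} := by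
  rintro x ⟨-, hx⟩ C ⟨hC, hsub⟩
  refine hC 1 (hsub (by simp)) u (hsub (by simp)) x ?_
  have h := (cs.weakLE_iff_leftInversions_subset hM).1 hx
  have e : symmDiff (cs.leftInversions x) (cs.leftInversions u) =
      cs.leftInversions u \ cs.leftInversions x := symmDiff_of_le h
  rw [cayleyGraph_dist, cayleyGraph_dist, cayleyGraph_dist, cs.length_inv_mul hM x, e, inv_one,
    one_mul, one_mul, ← cs.ncard_leftInversions hM, ← cs.ncard_leftInversions hM,
    add_comm, Set.ncard_sdiff_add_ncard_of_subset h (cs.finite_leftInversions hM u)]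

theorem mapsTo_weakMeet (hM : M.IsRightAngled) (u v : W) (s : Set W) :
    Set.MapsTo (fun x => (cs.weakMeet x u, cs.weakMeet x v)) s
      (cs.weakInterval 1 u ×ˢ cs.weakInterval 1 v) := by
  have h1 : ∀ x : W, cs.WeakLE 1 x := fun x => by
    simp [cs.weakLE_iff_leftInversions_subset hM, leftInversions_one]
  exact fun x _ => ⟨⟨h1 _, (cs.isWeakMeet_weakMeet hM x u).2.1⟩,
    ⟨h1 _, (cs.isWeakMeet_weakMeet hM x v).2.1⟩⟩

theorem injOn_weakMeet (hM : M.IsRightAngled) (u v : W) :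
    Set.InjOn (fun x => (cs.weakMeet x u, cs.weakMeet x v))
      (cs.cayleyGraph.geodHull {1, u, v}) := by
  have key : ∀ x ∈ cs.cayleyGraph.geodHull {1, u, v}, cs.leftInversions x =
      cs.leftInversions (cs.weakMeet x u) ∪ cs.leftInversions (cs.weakMeet x v) := by
    intro x hx
    rw [cs.leftInversions_weakMeet hM, cs.leftInversions_weakMeet hM, ← Set.inter_union_distrib_left,
      Set.inter_eq_left.2 (cs.leftInversions_subset_of_mem_geodHull hM hx)]
  intro x hx y hy hxy
  rw [Prod.mk.injEq] at hxy
  apply cs.leftInversions_injective hM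
  rw [key x hx, key y hy, hxy.1, hxy.2]

theorem mul_mem_geodHull_image {g x : W} {X : Set W} (hx : x ∈ cs.cayleyGraph.geodHull X) :
    g * x ∈ cs.cayleyGraph.geodHull ((g * ·) '' X) := by
  rintro C ⟨hC, hsub⟩
  refine hx {y | g * y ∈ C} ⟨fun u hu v hv w hw => hC _ hu _ hv _ ?_, Set.image_subset_iff.1 hsub⟩
  simpa [cayleyGraph_dist, mul_assoc] using hw

theorem mk_geodHull_image_mul_left (g : W) (X : Set W) :
    Cardinal.mk (cs.cayleyGraph.geodHull ((g * ·) '' X)) =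
      Cardinal.mk (cs.cayleyGraph.geodHull X) := by
  have h : cs.cayleyGraph.geodHull ((g * ·) '' X) = (g * ·) '' cs.cayleyGraph.geodHull X := by
    apply Set.Subset.antisymm
    · intro x hx
      refine ⟨g⁻¹ * x, ?_, mul_inv_cancel_left g x⟩
      have h1 := cs.mul_mem_geodHull_image (g := g⁻¹) hx
      rw [Set.image_image] at h1
      simpa only [inv_mul_cancel_left, Set.image_id'] using h1
    · rintro _ ⟨x, hx, rfl⟩
      exact cs.mul_mem_geodHull_image hx
  rw [h, Cardinal.mk_image_eq (mul_right_injective g)]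

theorem mk_geodHull_one_le (hM : M.IsRightAngled) (u v : W) :
    Cardinal.mk (cs.cayleyGraph.geodHull {1, u, v}) ≤
      Cardinal.mk (cs.cayleyGraph.geodHull {1, u}) *
        Cardinal.mk (cs.cayleyGraph.geodHull {1, v}) := by
  rw [← Cardinal.mk_setProd, ← Cardinal.mk_image_eq_of_injOn _ _ (cs.injOn_weakMeet hM u v)]
  refine Cardinal.mk_le_mk_of_subset (Set.image_subset_iff.2 fun x hx => ?_)
  exact Set.prod_mono (cs.weakInterval_subset_geodHull hM u) (cs.weakInterval_subset_geodHull hM v)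
    (cs.mapsTo_weakMeet hM u v _ hx)

/-- The translation by `v⁻¹` reduces the strong hull property to the case `v = 1`. -/
theorem strongHullProperty_cayleyGraph (hM : M.IsRightAngled) :
    cs.cayleyGraph.StrongHullProperty := by
  refine ⟨cs.cayleyGraph_connected, fun u v w => ?_⟩
  have h := cs.mk_geodHull_one_le hM (v⁻¹ * u) (v⁻¹ * w)
  rw [← cs.mk_geodHull_image_mul_left v, ← cs.mk_geodHull_image_mul_left v {1, v⁻¹ * u},
    ← cs.mk_geodHull_image_mul_left v {1, v⁻¹ * w}] at h
  simp only [Set.image_insert_eq, Set.image_singleton, mul_one, mul_inv_cancel_left] at h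
  rwa [Set.insert_comm u v {w}, Set.pair_comm u v]

end RightAngled

end CoxeterSystem

theorem mainTheorem4 {B W : Type*} [Group W] {M : CoxeterMatrix B} (cs : CoxeterSystem M W)
    (hM : M.IsRightAngled) :
    (∀ u v : W, cs.IsWeakMeet u v (cs.weakMeet u v)) ∧
    (∀ u v : W,
      cs.leftInversions (cs.weakMeet u v) = cs.leftInversions u ∩ cs.leftInversions v) ∧
    (∀ u v : W,
      Set.MapsTo (fun x : W => (cs.weakMeet x u, cs.weakMeet x v))
        (cs.cayleyGraph.geodHull {1, u, v})
        (cs.weakInterval 1 u ×ˢ cs.weakInterval 1 v) ∧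
      Set.InjOn (fun x : W => (cs.weakMeet x u, cs.weakMeet x v))
        (cs.cayleyGraph.geodHull {1, u, v})) ∧
    cs.cayleyGraph.StrongHullProperty :=
  ⟨cs.isWeakMeet_weakMeet hM, cs.leftInversions_weakMeet hM,
    fun u v => ⟨cs.mapsTo_weakMeet hM u v _, cs.injOn_weakMeet hM u v⟩,
    cs.strongHullProperty_cayleyGraph hM⟩
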